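/- Let $X$ be a Polish space, let $\mu$ be a Borel probability measure on $X$, and let $G$ be a Borel graph on $X$, i.e. a simple graph with vertex set $X$ whose edge relation is a Borel subset of $X^2$. Assume that $G$ is bipartite (has no odd cycles; the bipartition need not be Borel) and $\mu$-hyperfinite: there is a $G$-invariant $\mu$-conull Borel set $C\subseteq X$ such that the induced subgraph $G\upharpoonright C$ is the union of an increasing sequence of Borel graphs on $C$ all of whose connected components are finite. (A set is $G$-invariant if it is a union of connected components of $G$; $\mu$ is not assumed to be invariant under $G$.) Let $\Delta(G)$ be the supremum, as a cardinal, of the degrees of the vertices of $G$. For a Borel graph $H$ on a standard Borel space, let $\chi'_B(H)$ be the least cardinal $\kappa$ such that $H$ has a Borel proper edge colouring whose colours form a standard Borel space of cardinality at most $\kappa$, and let $\chi'_\mu(G)$ be the minimum of $\chi'_B(G\upharpoonright C)$ over all $G$-invariant $\mu$-conull Borel sets $C\subseteq X$. Then $$\chi'_\mu(G)\le \Delta(G)+1 ;$$ that is, there is a $G$-invariant $\mu$-conull Borel set $C\subseteq X$ such that $G\upharpoonright C$ has a Borel proper edge colouring with at most $\Delta(G)+1$ colours. -/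

import Mathlib

open MeasureTheory Cardinal

universe u

namespace BorelGraph

variable {V : Type u}

/-- A graph on a (standard Borel) space `V` is Borel if its edge relation is a Borel subset
of `V × V`. -/
def IsBorel [MeasurableSpace V] (G : SimpleGraph V) : Prop :=
  MeasurableSet {p : V × V | G.Adj p.1 p.2}

/-- A set of vertices is `G`-invariant if it is a union of connected components of `G`,
i.e. if it is closed under adjacency. -/
def IsInvariant (G : SimpleGraph V) (C : Set V) : Prop :=
  ∀ ⦃x y : V⦄, G.Adj x y → x ∈ C → y ∈ C

/-- All connected components of `G` are finite. -/
def IsComponentFinite (G : SimpleGraph V) : Prop :=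
  ∀ c : G.ConnectedComponent, c.supp.Finite

/-- `G` is hyperfinite: an increasing union of countably many component finite Borel graphs. -/
def IsHyperfinite [MeasurableSpace V] (G : SimpleGraph V) : Prop :=
  ∃ H : ℕ → SimpleGraph V, Monotone H ∧ (∀ n, IsBorel (H n)) ∧
    (∀ n, IsComponentFinite (H n)) ∧ ⨆ n, H n = G

/-- `C` is a `G`-invariant `μ`-conull Borel set. -/
def IsInvariantConull [MeasurableSpace V] (G : SimpleGraph V) (μ : Measure V) (C : Set V) :
    Prop :=
  MeasurableSet C ∧ IsInvariant G C ∧ μ Cᶜ = 0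

/-- `G` is `μ`-hyperfinite: the restriction of `G` to some invariant conull Borel set is
hyperfinite. -/
def IsMuHyperfinite [MeasurableSpace V] (G : SimpleGraph V) (μ : Measure V) : Prop :=
  ∃ C : Set V, IsInvariantConull G μ C ∧ IsHyperfinite (G.induce C)

/-- The maximum degree `Δ(G)`: the supremum of the degrees of the vertices, as a cardinal. -/
noncomputable def maxDegree (G : SimpleGraph V) : Cardinal.{u} :=
  ⨆ x : V, #(G.neighborSet x)

/-- A proper edge colouring of `G` (a proper vertex colouring of the line graph: distinct edges
sharing an endpoint get distinct colours) is Borel if it is Borel as a function on the set of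
pairs `(x, y)` that are edges of `G`. -/
def IsBorelEdgeColoring [MeasurableSpace V] (G : SimpleGraph V) {Y : Type u} [MeasurableSpace Y]
    (c : G.lineGraph.Coloring Y) : Prop :=
  Measurable fun p : {p : V × V // G.Adj p.1 p.2} =>
    c ⟨s(p.1.1, p.1.2), (G.mem_edgeSet).2 p.2⟩

/-- `G` has a Borel proper edge colouring with (at most) `κ` colours: the colours form a standard
Borel space of cardinality at most `κ`. -/
def BorelEdgeColorable [MeasurableSpace V] (G : SimpleGraph V) (κ : Cardinal.{u}) : Prop :=
  ∃ (Y : Type u) (_ : MeasurableSpace Y) (_ : StandardBorelSpace Y),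
    #Y ≤ κ ∧ ∃ c : G.lineGraph.Coloring Y, IsBorelEdgeColoring G c

/-- The Borel edge chromatic number of `G`: the least cardinal `κ` such that `G` has a Borel
proper edge colouring with `κ` colours. -/
noncomputable def borelEdgeChromaticNumber [MeasurableSpace V] (G : SimpleGraph V) :
    Cardinal.{u} :=
  sInf {κ | BorelEdgeColorable G κ}

/-- The `μ`-measurable edge chromatic number of `G`: the minimum of the Borel edge chromatic
numbers of the restrictions of `G` to invariant `μ`-conull Borel sets. -/
noncomputable def muEdgeChromaticNumber [MeasurableSpace V] (G : SimpleGraph V)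
    (μ : Measure V) : Cardinal.{u} :=
  sInf {κ | ∃ C : Set V, IsInvariantConull G μ C ∧ borelEdgeChromaticNumber (G.induce C) = κ}

end BorelGraph

namespace BorelGraph

open Set Function

/-! If `maxDegree G` is infinite, countably many colours suffice: the edges over the hyperfinite
part lie in countably many Borel graphs of partial functions (`exists_functional_cover_of_finite`,
resting on Novikov separation), and `exists_nat_edgeColoring` applies.

Let the maximum degree be `d`, finite. Borel–Cantelli gives, on an invariant conull set, a level
function `l` that is 1-Lipschitz along edges and whose sublevel sets span component finite graphs
(`exists_levels`). On such graphs any finite combinatorial problem solvable on each component is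
solvable in a Borel way (`exists_borel_solution`): in particular there are bipartitions and
matchings covering all vertices of degree `d`. These matchings, one for each block of `P`
consecutive levels, are glued. The gluing fails only near the level where one passes from a matching
to the next, and the failures are repaired by a second matching `N` confined to a narrow zone of
levels mod `P` (`exists_two_matchings`).

Deleting `M ∪ N` lowers the maximum degree, so one inducts on `d`. Each `M` takes a new colour. The
zones for different `d` are disjoint, so all the `N` share the colour 0, which is the one extra
colour. -/

/-! ### Novikov's separation theorem. -/

/-- A sequence of sets is Borel separable if it has Borel supersets with empty intersection. -/
def BorelSeparable {α : Type*} [MeasurableSpace α] (S : ℕ → Set α) : Prop :=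
  ∃ B : ℕ → Set α, (∀ n, S n ⊆ B n) ∧ (∀ n, MeasurableSet (B n)) ∧ ⋂ n, B n = ∅

/-- Contrapositive use: when one term of a non-separable sequence is cut into countably many pieces,
some piece gives a non-separable sequence again. -/
theorem BorelSeparable.of_iUnion {α : Type*} [MeasurableSpace α] {S : ℕ → Set α}
    {T : ℕ → ℕ → Set α} (p : ℕ) (hp : S p ⊆ ⋃ i, T i p) (hn : ∀ n ≠ p, ∀ i, S n ⊆ T i n)
    (hT : ∀ i, BorelSeparable (T i)) : BorelSeparable S := by
  choose B hB hBm hBe using hT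
  classical
  refine ⟨fun n => if n = p then ⋃ i, B i p else ⋂ i, B i n, fun n => ?_, fun n => ?_, ?_⟩
  · by_cases h : n = p
    · subst h
      simpa using hp.trans (iUnion_mono fun i => hB i n)
    · simpa [h] using fun i => (hn n h i).trans (hB i n)
  · by_cases h : n = p
    · simpa [h] using MeasurableSet.iUnion fun i => hBm i p
    · simpa [h] using MeasurableSet.iInter fun i => hBm i n
  · rw [eq_empty_iff_forall_notMem]
    intro x hx
    rw [mem_iInter] at hx
    have h1 := hx p
    simp only [if_true, mem_iUnion] at h1
    obtain ⟨i, hi⟩ := h1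
    have : x ∈ ⋂ n, B i n := by
      rw [mem_iInter]
      intro n
      by_cases h : n = p
      · rwa [h]
      · have := hx n
        simp only [h, if_false, mem_iInter] at this
        exact this i
    rw [hBe i] at this
    exact this

/-- Were the ranges not separable, repeated cutting would produce points `a n` all of whose cylinder
images stay non-separable. The points `f n (a n)` are not all equal, so disjoint open sets around
two of them separate small enough cylinder images, a contradiction. -/
theorem borelSeparable_range {α : Type*} [TopologicalSpace α] [T2Space α] [MeasurableSpace α]
    [OpensMeasurableSpace α] {f : ℕ → (ℕ → ℕ) → α} (hf : ∀ n, Continuous (f n))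
    (h : ⋂ n, range (f n) = ∅) : BorelSeparable fun n => range (f n) := by
  by_contra hsep
  -- The coordinates of all the points are revealed one at a time, along a pairing of `ℕ × ℕ`.
  let S : (ℕ → ℕ) → ℕ → ℕ → Set α := fun z k n =>
    f n '' {x | ∀ m, Nat.pair n m < k → x m = z (Nat.pair n m)}
  have hcongr : ∀ z z' k, (∀ j < k, z j = z' j) → S z k = S z' k := by
    intro z z' k hz
    funext n
    simp only [S]
    congr 1
    ext x
    exact forall_congr' fun m => imp_congr_right fun hm => by rw [hz _ hm]
  have hstep : ∀ z k, ¬ BorelSeparable (S z k) →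
      ∃ i, ¬ BorelSeparable (S (update z k i) (k + 1)) := by
    intro z k
    contrapose!
    intro H
    refine BorelSeparable.of_iUnion (Nat.unpair k).1 ?_ ?_ H
    · rintro _ ⟨x, hx, rfl⟩
      refine mem_iUnion.2 ⟨x (Nat.unpair k).2, x, fun m hm => ?_, rfl⟩
      by_cases hk : Nat.pair (Nat.unpair k).1 m = k
      · rw [hk, update_self]
        congr 1
        have := congrArg (fun t => (Nat.unpair t).2) hk
        simpa using this
      · rw [update_of_ne hk]
        exact hx m (by omega)
    · rintro n hn i _ ⟨x, hx, rfl⟩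
      refine ⟨x, fun m hm => ?_, rfl⟩
      have hk : Nat.pair n m ≠ k := by
        rintro rfl
        simp at hn
      rw [update_of_ne hk]
      exact hx m (by omega)
  choose! i hi using hstep
  let zs : ℕ → ℕ → ℕ := fun k => Nat.rec (fun _ => 0) (fun k z => update z k (i z k)) k
  have zs_succ : ∀ k, zs (k + 1) = update (zs k) k (i (zs k) k) := fun k => rfl
  have hbad : ∀ k, ¬ BorelSeparable (S (zs k) k) := by
    intro k
    induction k with
    | zero =>
      have : S (zs 0) 0 = fun n => range (f n) := by
        funext n
        simp [S]
      rwa [this]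
    | succ k ih => exact hi _ _ ih
  let z : ℕ → ℕ := fun j => zs (j + 1) j
  have hz : ∀ k, ∀ j < k, zs k j = z j := by
    intro k
    induction k with
    | zero => intro j hj; omega
    | succ k ih =>
      intro j hj
      by_cases hjk : j = k
      · rw [hjk]
      · rw [zs_succ, update_of_ne hjk]
        exact ih j (by omega)
  replace hbad : ∀ k, ¬ BorelSeparable (S z k) := fun k => by
    rw [← hcongr _ _ k (hz k)]
    exact hbad k
  let a : ℕ → ℕ → ℕ := fun n m => z (Nat.pair n m)
  have hne : ∃ n, f n (a n) ≠ f 0 (a 0) := by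
    by_contra! hall
    have : f 0 (a 0) ∈ ⋂ n, range (f n) := mem_iInter.2 fun n => ⟨a n, hall n⟩
    rw [h] at this
    exact this
  obtain ⟨n, hn⟩ := hne
  have hn0 : n ≠ 0 := by
    rintro rfl
    exact hn rfl
  obtain ⟨U, V, hU, hV, haU, haV, hUV⟩ := t2_separation hn
  have hcyl : ∀ n (W : Set α), IsOpen W → f n (a n) ∈ W → ∃ K, ∀ k ≥ K, S z k n ⊆ W := by
    intro n W hW haW
    have hop : IsOpen (f n ⁻¹' W) := hW.preimage (hf n)
    obtain ⟨M, hM⟩ := (PiNat.isOpen_iff_dist (E := fun _ => ℕ) (f n ⁻¹' W)).1 hop (a n) haW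
    obtain ⟨hM0, hM⟩ := hM
    obtain ⟨L, hL⟩ := exists_pow_lt_of_lt_one hM0 (by norm_num : (1 / 2 : ℝ) < 1)
    refine ⟨(Finset.range L).sup (fun m => Nat.pair n m + 1), fun k hk => ?_⟩
    rintro _ ⟨x, hx, rfl⟩
    refine hM x (lt_of_le_of_lt ?_ hL)
    rw [← PiNat.mem_cylinder_iff_dist_le, PiNat.mem_cylinder_comm]
    intro m hm
    refine hx m (lt_of_lt_of_le (Nat.lt_succ_self _) (le_trans ?_ hk))
    exact Finset.le_sup (f := fun m => Nat.pair n m + 1) (Finset.mem_range.2 hm)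
  obtain ⟨K1, hK1⟩ := hcyl n U hU haU
  obtain ⟨K2, hK2⟩ := hcyl 0 V hV haV
  refine hbad (max K1 K2) ⟨fun j => if j = n then U else if j = 0 then V else univ,
    fun j => ?_, fun j => ?_, ?_⟩
  · dsimp only
    split_ifs with h1 h2
    · subst h1; exact hK1 _ (le_max_left _ _)
    · subst h2; exact hK2 _ (le_max_right _ _)
    · exact subset_univ _
  · dsimp only
    split_ifs
    exacts [hU.measurableSet, hV.measurableSet, MeasurableSet.univ]
  · rw [eq_empty_iff_forall_notMem]
    intro x hx
    rw [mem_iInter] at hx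
    have h1 := hx n
    have h2 := hx 0
    simp only [if_true, if_neg hn0.symm] at h1 h2
    exact disjoint_left.1 hUV h1 h2

/-- **Novikov's separation theorem**: a sequence of analytic sets with empty intersection has Borel
supersets with empty intersection. -/
theorem borelSeparable_of_analyticSet {α : Type*} [TopologicalSpace α] [T2Space α]
    [MeasurableSpace α] [OpensMeasurableSpace α] {A : ℕ → Set α} (hA : ∀ n, AnalyticSet (A n))
    (h : ⋂ n, A n = ∅) : BorelSeparable A := by
  by_cases hem : ∃ n, A n = ∅
  · obtain ⟨n, hn⟩ := hem
    classical
    refine ⟨fun k => if k = n then ∅ else univ, fun k => ?_, fun k => ?_, ?_⟩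
    · dsimp only
      split_ifs with hk
      · rw [hk, hn]
      · exact subset_univ _
    · dsimp only
      split_ifs <;> simp
    · rw [eq_empty_iff_forall_notMem]
      intro x hx
      have := mem_iInter.1 hx n
      simp at this
  · push Not at hem
    have : ∀ n, ∃ f : (ℕ → ℕ) → α, Continuous f ∧ range f = A n := by
      intro n
      have := hA n
      rw [AnalyticSet] at this
      exact this.resolve_left (hem n).ne_empty
    choose f hf hfA using this
    obtain rfl : (fun n => range (f n)) = A := funext hfA
    exact borelSeparable_range hf h

/-! ### Borel partial functions and countable edge colourings. -/

/-- A Borel set with finite vertical sections is a countable union of Borel graphs of partial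
functions. -/
theorem exists_functional_cover_of_finite {V : Type*} [MeasurableSpace V] [StandardBorelSpace V]
    {E : Set (V × V)} (hE : MeasurableSet E) (hfin : ∀ x, {y | (x, y) ∈ E}.Finite) :
    ∃ Q : ℕ → Set (V × V), (∀ n, MeasurableSet (Q n)) ∧
      (∀ n x y z, (x, y) ∈ Q n → (x, z) ∈ Q n → y = z) ∧ E = ⋃ n, Q n := by
  let := upgradeStandardBorel V
  have hb := TopologicalSpace.isBasis_countableBasis V
  obtain ⟨U, hU⟩ := ((TopologicalSpace.countable_countableBasis V).insert ∅).exists_eq_range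
    (insert_nonempty _ _)
  have hUo : ∀ n, IsOpen (U n) := by
    intro n
    have : U n ∈ insert ∅ (TopologicalSpace.countableBasis V) := hU ▸ mem_range_self n
    rcases this with h | h
    · rw [h]
      exact isOpen_empty
    · exact hb.isOpen h
  -- `E \ A n` consists of the points `(x, y)` such that `U n` isolates `y` in the section at `x`.
  -- It is only coanalytic; Novikov separation shrinks these sets to Borel ones that still cover
  -- `E`.
  let A : ℕ → Set (V × V) := fun n => (E ∩ Prod.snd ⁻¹' (U n)ᶜ) ∪
    (fun p : (V × V) × V => p.1) '' {p | p.1 ∈ E ∧ (p.1.1, p.2) ∈ E ∧ p.2 ∈ U n ∧ p.2 ≠ p.1.2}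
  have hA : ∀ n, AnalyticSet (A n) := by
    intro n
    have h1 : AnalyticSet (E ∩ Prod.snd ⁻¹' (U n)ᶜ) :=
      (hE.inter (measurable_snd (hUo n).measurableSet.compl)).analyticSet
    have h2 : AnalyticSet ((fun p : (V × V) × V => p.1) ''
        {p | p.1 ∈ E ∧ (p.1.1, p.2) ∈ E ∧ p.2 ∈ U n ∧ p.2 ≠ p.1.2}) := by
      refine (MeasurableSet.analyticSet ?_).image_of_continuous continuous_fst
      refine (measurable_fst hE).inter (MeasurableSet.inter ?_ (MeasurableSet.inter ?_ ?_))
      · exact (measurable_fst.fst.prodMk measurable_snd) hE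
      · exact measurable_snd (hUo n).measurableSet
      · exact (measurableSet_eq_fun measurable_snd measurable_fst.snd).compl
    rw [show A n = ⋃ b : Bool, cond b _ _ from union_eq_iUnion]
    refine AnalyticSet.iUnion fun b => ?_
    cases b
    exacts [h2, h1]
  have hAe : ⋂ n, A n = ∅ := by
    rw [eq_empty_iff_forall_notMem]
    rintro ⟨x, y⟩ hxy
    rw [mem_iInter] at hxy
    have hW : IsOpen ({z | (x, z) ∈ E} \ {y})ᶜ := (hfin x).sdiff.isClosed.isOpen_compl
    obtain ⟨u, hu, hyu, huW⟩ := hb.exists_subset_of_mem_open (show y ∈ _ by simp) hW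
    obtain ⟨n, rfl⟩ : u ∈ range U := hU ▸ mem_insert_of_mem _ hu
    rcases hxy n with h | ⟨⟨p, z⟩, ⟨_, h2, h3, h4⟩, rfl⟩
    · exact h.2 hyu
    · exact huW h3 ⟨h2, h4⟩
  obtain ⟨B, hAB, hBm, hBe⟩ := borelSeparable_of_analyticSet hA hAe
  refine ⟨fun n => E \ B n, fun n => hE.diff (hBm n), ?_, ?_⟩
  · intro n x y z hy hz
    have hyA : (x, y) ∉ A n := fun h => hy.2 (hAB n h)
    have hzA : (x, z) ∉ A n := fun h => hz.2 (hAB n h)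
    have hzU : z ∈ U n := by
      by_contra hzU
      exact hzA (Or.inl ⟨hz.1, hzU⟩)
    by_contra hyz
    exact hyA (Or.inr ⟨((x, y), z), ⟨hy.1, hz.1, hzU, fun h => hyz h.symm⟩, rfl⟩)
  · rw [← sdiff_iInter, hBe, sdiff_empty]

/-- A Borel partial function is the restriction of a Borel function. -/
theorem exists_measurable_extension {V : Type*} [MeasurableSpace V] [StandardBorelSpace V]
    {Q : Set (V × V)} (hQ : MeasurableSet Q) (hf : ∀ x y z, (x, y) ∈ Q → (x, z) ∈ Q → y = z) :
    ∃ φ : V → V, Measurable φ ∧ ∀ x y, (x, y) ∈ Q → φ x = y := by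
  classical
  have hinj : InjOn Prod.fst Q := by
    rintro ⟨x, y⟩ h ⟨x', z⟩ h' (rfl : x = x')
    rw [hf x y z h h']
  refine ⟨fun x => if h : ∃ y, (x, y) ∈ Q then h.choose else x, fun B hB => ?_, ?_⟩
  · have : (fun x => if h : ∃ y, (x, y) ∈ Q then h.choose else x) ⁻¹' B =
        Prod.fst '' (Q ∩ Prod.snd ⁻¹' B) ∪ (B \ Prod.fst '' Q) := by
      ext x
      simp only [mem_preimage, mem_union, mem_image, mem_inter_iff, Prod.exists, exists_and_right,
        exists_eq_right, mem_sdiff]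
      by_cases h : ∃ y, (x, y) ∈ Q
      · simp only [h, dif_pos, not_true, and_false, or_false]
        constructor
        · exact fun hx => ⟨_, h.choose_spec, hx⟩
        · rintro ⟨y, hy, hyB⟩
          rwa [hf _ _ _ h.choose_spec hy]
      · simp only [h, dif_neg, not_false_iff, and_true]
        constructor
        · exact Or.inr
        · rintro (⟨y, hy, _⟩ | hx)
          · exact absurd ⟨y, hy⟩ h
          · exact hx
    rw [this]
    exact ((hQ.inter (measurable_snd hB)).image_of_measurable_injOn measurable_fst
      (hinj.mono inter_subset_left)).union
      (hB.diff (hQ.image_of_measurable_injOn measurable_fst hinj))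
  · intro x y hxy
    have h : ∃ y, (x, y) ∈ Q := ⟨y, hxy⟩
    simp only [h, dif_pos]
    exact hf _ _ _ h.choose_spec hxy

/-- A graph whose edges are covered by countably many Borel partial functions has a Borel proper
edge colouring with countably many colours. -/
theorem exists_nat_edgeColoring {V : Type*} [MeasurableSpace V] [StandardBorelSpace V]
    {G : SimpleGraph V} (hG : MeasurableSet {p : V × V | G.Adj p.1 p.2}) {Q : ℕ → Set (V × V)}
    (hQ : ∀ n, MeasurableSet (Q n))
    (hf : ∀ n x y z, (x, y) ∈ Q n → (x, z) ∈ Q n → y = z)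
    (hcov : ∀ x y, G.Adj x y → ∃ n, (x, y) ∈ Q n) :
    ∃ c : V → V → ℕ, Measurable (fun p : V × V => c p.1 p.2) ∧ (∀ x y, c x y = c y x) ∧
      ∀ x y z, G.Adj x y → G.Adj x z → c x y = c x z → y = z := by
  classical
  obtain ⟨f, hfm⟩ := exists_measurableEmbedding_real V
  -- The rational separates the endpoints, so a vertex cannot be the lower end of one edge and the
  -- upper end of another edge of the same colour.
  let D : ℚ × ℕ × ℕ → Set (V × V) := fun t => {p | f p.1 < t.1 ∧ (t.1 : ℝ) ≤ f p.2 ∧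
    p ∈ Q t.2.1 ∧ p.swap ∈ Q t.2.2}
  have hD : ∀ t, MeasurableSet (D t) := fun t =>
    (measurableSet_lt (hfm.measurable.comp measurable_fst) measurable_const).inter
      ((measurableSet_le measurable_const (hfm.measurable.comp measurable_snd)).inter
        ((hQ _).inter (measurable_swap (hQ _))))
  obtain ⟨g, hg⟩ := exists_surjective_nat (ℚ × ℕ × ℕ)
  let R : V × V → ℕ → Prop := fun p n => p ∈ D (g n) ∨ p.swap ∈ D (g n) ∨ ¬ G.Adj p.1 p.2
  have hDex : ∀ x y, G.Adj x y → f x < f y → ∃ n, (x, y) ∈ D (g n) := by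
    intro x y hxy hlt
    obtain ⟨q, hq1, hq2⟩ := exists_rat_btwn hlt
    obtain ⟨n, hn⟩ := hcov x y hxy
    obtain ⟨m, hm⟩ := hcov y x hxy.symm
    obtain ⟨k, hk⟩ := hg (q, n, m)
    refine ⟨k, ?_⟩
    rw [hk]
    exact ⟨hq1, hq2.le, hn, hm⟩
  have hex : ∀ p, ∃ n, R p n := by
    rintro ⟨x, y⟩
    by_cases hxy : G.Adj x y
    · rcases lt_trichotomy (f x) (f y) with h | h | h
      · obtain ⟨n, hn⟩ := hDex x y hxy h
        exact ⟨n, Or.inl hn⟩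
      · exact absurd (hfm.injective h) hxy.ne
      · obtain ⟨n, hn⟩ := hDex y x hxy.symm h
        exact ⟨n, Or.inr (Or.inl hn)⟩
    · exact ⟨0, Or.inr (Or.inr hxy)⟩
  refine ⟨fun x y => Nat.find (hex (x, y)), ?_, ?_, ?_⟩
  · exact measurable_find hex fun n =>
      (hD _).union ((measurable_swap (hD _)).union hG.compl)
  · intro x y
    have : ∀ n, R (x, y) n ↔ R (y, x) n := fun n => by
      simp only [R, Prod.swap_prod_mk, G.adj_comm x y]
      tauto
    exact Nat.find_congr' (this _)
  · intro x y z hxy hxz h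
    have h1 : R (x, y) _ := Nat.find_spec (hex (x, y))
    have h2 : R (x, z) _ := Nat.find_spec (hex (x, z))
    dsimp only at h
    rw [← h] at h2
    rcases h1 with ⟨a1, a2, a3, a4⟩ | ⟨a1, a2, a3, a4⟩ | h1
    · rcases h2 with ⟨b1, b2, b3, b4⟩ | ⟨b1, b2, b3, b4⟩ | h2
      · exact hf _ _ _ _ a3 b3
      · exact absurd (lt_of_lt_of_le a1 b2) (lt_irrefl _)
      · exact absurd hxz h2
    · rcases h2 with ⟨b1, b2, b3, b4⟩ | ⟨b1, b2, b3, b4⟩ | h2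
      · exact absurd (lt_of_lt_of_le b1 a2) (lt_irrefl _)
      · exact hf _ _ _ _ a4 b4
      · exact absurd hxz h2
    · exact absurd hxy h1

/-! ### Borel choice on finite components. -/

section Selection

variable {V : Type*} [MeasurableSpace V] {H : SimpleGraph V}

/-- The connectedness relation of a Borel graph generated by countably many Borel functions is
generated by countably many Borel functions. -/
theorem exists_measurable_reachable_maps (hH : MeasurableSet {p : V × V | H.Adj p.1 p.2})
    {φ : ℕ → V → V} (hφ : ∀ k, Measurable (φ k)) (hgen : ∀ x y, H.Adj x y → ∃ k, φ k x = y) :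
    ∃ g : ℕ → V → V, (∀ n, Measurable (g n)) ∧ ∀ x y, H.Reachable x y ↔ ∃ n, g n x = y := by
  classical
  -- `φ k x` need not be a neighbour of `x`; fixing `x` in that case keeps all compositions inside
  -- components.
  let ψ : ℕ → V → V := fun k x => if H.Adj x (φ k x) then φ k x else x
  have hψ : ∀ k, Measurable (ψ k) := fun k =>
    Measurable.ite ((measurable_id.prodMk (hφ k)) hH) (hφ k) measurable_id
  let act : List ℕ → V → V := fun w => w.foldr (fun k f => f ∘ ψ k) id
  have hact : ∀ w, Measurable (act w) := by
    intro w
    induction w with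
    | nil => exact measurable_id
    | cons k w ih => exact ih.comp (hψ k)
  have hreach : ∀ w x, H.Reachable x (act w x) := by
    intro w
    induction w with
    | nil => exact fun x => SimpleGraph.Reachable.refl x
    | cons k w ih =>
      intro x
      refine SimpleGraph.Reachable.trans ?_ (ih (ψ k x))
      simp only [ψ]
      split_ifs with h
      · exact h.reachable
      · exact SimpleGraph.Reachable.refl x
  obtain ⟨enum, henum⟩ := exists_surjective_nat (List ℕ)
  refine ⟨fun n => act (enum n), fun n => hact _, fun x y => ⟨?_, ?_⟩⟩
  · rintro ⟨p⟩
    suffices ∃ w, act w x = y by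
      obtain ⟨w, hw⟩ := this
      obtain ⟨n, rfl⟩ := henum w
      exact ⟨n, hw⟩
    induction p with
    | nil => exact ⟨[], rfl⟩
    | cons h p ih =>
      obtain ⟨w, hw⟩ := ih
      obtain ⟨k, hk⟩ := hgen _ _ h
      refine ⟨k :: w, ?_⟩
      subst hk
      change act w (ψ k _) = _
      simpa only [ψ, if_pos h] using hw
  · rintro ⟨n, rfl⟩
    exact hreach _ _

/-- **Borel selection on finite components**: if on every finite graph isomorphic to a component of
`H` there is a relation satisfying `P`, then such relations can be chosen in a Borel way,
simultaneously on all components. -/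
theorem exists_borel_solution [StandardBorelSpace V]
    (hH : MeasurableSet {p : V × V | H.Adj p.1 p.2})
    {g : ℕ → V → V} (hg : ∀ n, Measurable (g n))
    (hreach : ∀ x y, H.Reachable x y ↔ ∃ n, g n x = y)
    (hfin : ∀ x, {y | H.Reachable x y}.Finite)
    (P : ∀ N : ℕ, (Fin N → Fin N → Prop) → (Fin N → Fin N → Prop) → Prop)
    (hP : ∀ (N : ℕ) (e : Fin N → V), Injective e → ∃ s, P N (fun a b => H.Adj (e a) (e b)) s) :
    ∃ M : Set (V × V), MeasurableSet M ∧ (∀ x y, (x, y) ∈ M → H.Reachable x y) ∧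
      ∀ x, ∃ (N : ℕ) (e : Fin N → V), Injective e ∧ (∀ y, H.Reachable x y ↔ y ∈ range e) ∧
        P N (fun a b => H.Adj (e a) (e b)) (fun a b => (e a, e b) ∈ M) := by
  classical
  obtain ⟨f, hf⟩ := exists_measurableEmbedding_real V
  let : LinearOrder V := LinearOrder.lift' f hf.injective
  -- One solution is fixed for each labelled finite graph. Since components are always enumerated in
  -- increasing order, all points of a component read off the same solution.
  choose! F hF using fun (N : ℕ) (A : Fin N → Fin N → Prop) (h : ∃ s, P N A s) => h
  -- The words `w` list the component of `x` increasingly and without omission.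
  let E : ∀ N : ℕ, (Fin N → ℕ) → V → Prop := fun N w x =>
    StrictMono (fun i => g (w i) x) ∧ ∀ v, ∃ i, g v x = g (w i) x
  let M : Set (V × V) := {p | ∃ (N : ℕ) (w : Fin N → ℕ) (i j : Fin N) (A : Fin N → Fin N → Prop),
    F N A i j ∧ E N w p.1 ∧ g (w i) p.1 = p.1 ∧ g (w j) p.1 = p.2 ∧
      ∀ a b, H.Adj (g (w a) p.1) (g (w b) p.1) ↔ A a b}
  have hEM : ∀ N w, MeasurableSet {x | E N w x} := by
    intro N w
    have hE : {x | E N w x} = {x | StrictMono (fun i => g (w i) x)} ∩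
        {x | ∀ v, ∃ i, g v x = g (w i) x} := rfl
    rw [hE]
    refine MeasurableSet.inter ?_ ?_
    · have : {x | StrictMono (fun i => g (w i) x)} =
          ⋂ (a : Fin N) (b : Fin N) (_ : a < b), {x | f (g (w a) x) < f (g (w b) x)} := by
        ext x
        simp only [mem_iInter]
        exact ⟨fun h a b hab => h hab, fun h a b hab => h a b hab⟩
      rw [this]
      exact MeasurableSet.iInter fun a => MeasurableSet.iInter fun b => MeasurableSet.iInter
        fun _ => measurableSet_lt (hf.measurable.comp (hg _)) (hf.measurable.comp (hg _))
    · have : {x | ∀ v, ∃ i, g v x = g (w i) x} = ⋂ v, ⋃ i, {x | g v x = g (w i) x} := by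
        ext x
        simp
      rw [this]
      exact MeasurableSet.iInter fun v => MeasurableSet.iUnion fun i =>
        measurableSet_eq_fun (hg _) (hg _)
  have hMM : MeasurableSet M := by
    have : M = ⋃ (N : ℕ) (w : Fin N → ℕ) (i : Fin N) (j : Fin N) (A : Fin N → Fin N → Prop)
        (_ : F N A i j), {p | E N w p.1} ∩ ({p | g (w i) p.1 = p.1} ∩ ({p | g (w j) p.1 = p.2} ∩
          ⋂ (a : Fin N) (b : Fin N), {p | H.Adj (g (w a) p.1) (g (w b) p.1) ↔ A a b})) := by
      ext p
      simp only [M, mem_iUnion, mem_inter_iff, mem_iInter, mem_ofPred_eq, exists_prop]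
    rw [this]
    refine MeasurableSet.iUnion fun N => MeasurableSet.iUnion fun w => MeasurableSet.iUnion fun i =>
      MeasurableSet.iUnion fun j => MeasurableSet.iUnion fun A => MeasurableSet.iUnion fun _ => ?_
    refine (measurable_fst (hEM N w)).inter ((measurableSet_eq_fun ((hg _).comp measurable_fst)
      measurable_fst).inter ((measurableSet_eq_fun ((hg _).comp measurable_fst)
      measurable_snd).inter (MeasurableSet.iInter fun a => MeasurableSet.iInter fun b => ?_)))
    have hab : MeasurableSet {p : V × V | H.Adj (g (w a) p.1) (g (w b) p.1)} :=
      (((hg (w a)).comp measurable_fst).prodMk ((hg (w b)).comp measurable_fst)) hH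
    by_cases hA : A a b
    · simpa [hA] using hab
    · simp only [hA, iff_false]
      exact hab.compl
  have huniq : ∀ (N N' : ℕ) (e : Fin N → V) (e' : Fin N' → V), StrictMono e → StrictMono e' →
      range e = range e' → ∃ h : N = N', ∀ i, e i = e' (Fin.cast h i) := by
    intro N N' e e' he he' hr
    have h : N = N' := by
      have h1 := Nat.card_range_of_injective he.injective
      have h2 := Nat.card_range_of_injective he'.injective
      rw [hr, h2] at h1
      simpa using h1.symm
    subst h
    refine ⟨rfl, fun i => ?_⟩
    rw [(StrictMono.range_inj he he').1 hr]
    rfl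
  refine ⟨M, hMM, ?_, ?_⟩
  · rintro x y ⟨N, w, i, j, A, -, -, -, h, -⟩
    exact (hreach x y).2 ⟨_, h⟩
  · intro x
    let T := (hfin x).toFinset
    let e : Fin T.card → V := T.orderEmbOfFin rfl
    have he : StrictMono e := (T.orderEmbOfFin rfl).strictMono
    have her : ∀ y, H.Reachable x y ↔ y ∈ range e := by
      intro y
      simp only [e, Finset.range_orderEmbOfFin, Finset.mem_coe, T, Finite.mem_toFinset,
        mem_ofPred_eq]
    refine ⟨T.card, e, he.injective, her, ?_⟩
    have hkey : ∀ i j, (e i, e j) ∈ M ↔ F T.card (fun a b => H.Adj (e a) (e b)) i j := by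
      intro i j
      have hcomp : ∀ y, (∃ n, g n (e i) = y) ↔ y ∈ range e := by
        intro y
        have hxi : H.Reachable x (e i) := (her _).2 ⟨i, rfl⟩
        rw [← hreach, ← her]
        exact ⟨hxi.trans, hxi.symm.trans⟩
      constructor
      · rintro ⟨N, w, i', j', A, hFA, ⟨hmono, hall⟩, hi, hj, hA⟩
        dsimp only at hmono hall hi hj hA
        have hr : range (fun a => g (w a) (e i)) = range e := by
          ext y
          rw [← hcomp]
          constructor
          · rintro ⟨a, rfl⟩
            exact ⟨_, rfl⟩
          · rintro ⟨n, rfl⟩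
            obtain ⟨a, ha⟩ := hall n
            exact ⟨a, ha.symm⟩
        obtain ⟨h, heq⟩ := huniq _ _ _ _ hmono he hr
        subst h
        simp only [Fin.cast_eq_self] at heq
        simp only [heq] at hi hj hA
        obtain rfl := he.injective hi
        obtain rfl := he.injective hj
        have : A = fun a b => H.Adj (e a) (e b) := by
          funext a b
          exact propext (hA a b).symm
        rwa [this] at hFA
      · intro h
        choose w hw using fun a => (hcomp (e a)).2 ⟨a, rfl⟩
        refine ⟨T.card, w, i, j, _, h, ⟨?_, ?_⟩, hw i, hw j, ?_⟩
        · simpa only [hw] using he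
        · intro v
          obtain ⟨a, ha⟩ := (hcomp _).1 ⟨v, rfl⟩
          exact ⟨a, by rw [hw, ha]⟩
        · intro a b
          simp only [hw]
    simp only [hkey]
    exact hF _ _ (hP _ e he.injective)

end Selection

/-! ### Matchings covering the vertices of maximum degree. -/

/-- A finite bipartite graph of maximum degree at most `d` has a matching covering all the vertices
of degree `d`. -/
theorem exists_matching_of_degree_le {K : Type*} [Fintype K] (G : SimpleGraph K) (S : Set K)
    (hS : ∀ x y, G.Adj x y → (x ∈ S ↔ y ∉ S)) {d : ℕ} (hd0 : 0 < d)
    (hd : ∀ x, (G.neighborSet x).encard ≤ d) :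
    ∃ m : K → K → Prop, (∀ x y, m x y → m y x) ∧ (∀ x y, m x y → G.Adj x y) ∧
      (∀ x y z, m x y → m x z → y = z) ∧ ∀ x, (G.neighborSet x).encard = d → ∃ y, m x y := by
  classical
  have hdeg : ∀ x, (G.neighborSet x).encard = G.degree x := fun x => by
    rw [← G.card_neighborFinset_eq_degree, ← Set.encard_coe_eq_coe_finsetCard,
      G.coe_neighborFinset]
  simp only [hdeg, Nat.cast_le, Nat.cast_inj] at hd ⊢
  -- Loops pad every row and column sum to `d`, so Hall's condition holds. Vertices of degree `d`
  -- get no loop, hence the resulting permutation moves them along an edge.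
  let W : K → K → ℕ := fun x y =>
    (if G.Adj x y then 1 else 0) + if x = y then d - G.degree x else 0
  have hrow : ∀ x, ∑ y, W x y = d := by
    intro x
    simp only [W, Finset.sum_add_distrib, Finset.sum_ite_eq, Finset.mem_univ, if_true]
    rw [Finset.sum_boole, ← G.neighborFinset_eq_filter, G.card_neighborFinset_eq_degree]
    have := hd x
    simp only [Nat.cast_id]
    omega
  have hcol : ∀ y, ∑ x, W x y = d := by
    intro y
    rw [← hrow y]
    refine Finset.sum_congr rfl fun x _ => ?_
    simp only [W, G.adj_comm x y, eq_comm (a := x) (b := y)]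
    congr 1
    by_cases h : y = x
    · subst h
      simp
    · simp [h]
  let t : K → Finset K := fun x => {y | W x y ≠ 0}
  have hall : ∀ s : Finset K, s.card ≤ (s.biUnion t).card := by
    intro s
    have h1 : ∑ x ∈ s, ∑ y ∈ s.biUnion t, W x y = s.card * d := by
      rw [Finset.sum_const_nat]
      intro x hx
      rw [← hrow x]
      refine Finset.sum_subset (Finset.subset_univ _) fun y _ hy => ?_
      by_contra hW
      exact hy (Finset.mem_biUnion.2 ⟨x, hx, by simpa [t] using hW⟩)
    have h2 : ∑ x ∈ s, ∑ y ∈ s.biUnion t, W x y ≤ (s.biUnion t).card * d := by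
      rw [Finset.sum_comm]
      refine Finset.sum_le_card_nsmul _ _ _ fun y _ => ?_
      rw [← hcol y]
      exact Finset.sum_le_univ_sum_of_nonneg fun _ => Nat.zero_le _
    rw [h1] at h2
    exact Nat.le_of_mul_le_mul_right h2 hd0
  obtain ⟨σ, hσ, hσt⟩ := (Finset.all_card_le_biUnion_card_iff_exists_injective t).1 hall
  have hσ' : ∀ x, W x (σ x) ≠ 0 := fun x => by simpa [t] using hσt x
  have hadj : ∀ x, σ x ≠ x → G.Adj x (σ x) := by
    intro x hx
    by_contra h
    exact hσ' x (by simp [W, h, hx.symm])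
  have hcrit : ∀ x, G.degree x = d → σ x ≠ x := by
    intro x hx h
    exact hσ' x (by simp [W, h, hx])
  -- Keeping only the arrows of `σ` that leave `S` gives a matching. A vertex of degree `d` outside
  -- `S` is reached from its `σ`-preimage.
  let r : K → K → Prop := fun x y => x ∈ S ∧ σ x = y ∧ y ≠ x
  have hradj : ∀ x y, r x y → G.Adj x y := by
    rintro x y ⟨-, rfl, h⟩
    exact hadj x h
  have hrS : ∀ x y, r x y → y ∉ S := fun x y h => (hS x y (hradj x y h)).1 h.1
  refine ⟨fun x y => r x y ∨ r y x, fun x y => Or.symm, ?_, ?_, ?_⟩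
  · rintro x y (h | h)
    · exact hradj x y h
    · exact (hradj y x h).symm
  · rintro x y z (h | h) (h' | h')
    · exact h.2.1.symm.trans h'.2.1
    · exact absurd h.1 (hrS z x h')
    · exact absurd h'.1 (hrS y x h)
    · exact hσ (h.2.1.trans h'.2.1.symm)
  · intro x hx
    by_cases hxS : x ∈ S
    · exact ⟨σ x, Or.inl ⟨hxS, rfl, hcrit x hx⟩⟩
    · obtain ⟨y, rfl⟩ := (Finite.injective_iff_surjective.1 hσ) x
      have hy : σ y ≠ y := fun h => hcrit _ hx (by rw [h, h])
      refine ⟨y, Or.inr ⟨?_, rfl, hy⟩⟩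
      exact (hS _ _ (hadj y hy)).2 hxS

section ComponentFinite

variable {V : Type*} [MeasurableSpace V] [StandardBorelSpace V] {H : SimpleGraph V}

/-- A bipartite component finite Borel graph has a Borel bipartition. -/
theorem exists_borel_bipartition (hH : MeasurableSet {p : V × V | H.Adj p.1 p.2})
    {φ : ℕ → V → V} (hφ : ∀ k, Measurable (φ k)) (hgen : ∀ x y, H.Adj x y → ∃ k, φ k x = y)
    (hfin : ∀ x, {y | H.Reachable x y}.Finite)
    (hbip : ∃ S : Set V, ∀ x y, H.Adj x y → (x ∈ S ↔ y ∉ S)) :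
    ∃ S : Set V, MeasurableSet S ∧ ∀ x y, H.Adj x y → (x ∈ S ↔ y ∉ S) := by
  obtain ⟨S, hS⟩ := hbip
  obtain ⟨g, hg, hreach⟩ := exists_measurable_reachable_maps hH hφ hgen
  obtain ⟨M, hM, -, hMP⟩ := exists_borel_solution hH hg hreach hfin
    (fun N A s => ∀ a b, A a b → (s a a ↔ ¬ s b b))
    (fun N e _ => ⟨fun a _ => e a ∈ S, fun a b h => hS _ _ h⟩)
  refine ⟨{x | (x, x) ∈ M}, (measurable_id.prodMk measurable_id) hM, fun x y hxy => ?_⟩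
  obtain ⟨N, e, -, hr, h⟩ := hMP x
  obtain ⟨a, rfl⟩ := (hr x).1 (SimpleGraph.Reachable.refl x)
  obtain ⟨b, rfl⟩ := (hr y).1 hxy.reachable
  exact h a b hxy

/-- A bipartite component finite Borel graph of maximum degree at most `d` has a Borel matching
covering all the vertices of degree `d`. -/
theorem exists_borel_matching (hH : MeasurableSet {p : V × V | H.Adj p.1 p.2})
    {φ : ℕ → V → V} (hφ : ∀ k, Measurable (φ k)) (hgen : ∀ x y, H.Adj x y → ∃ k, φ k x = y)
    (hfin : ∀ x, {y | H.Reachable x y}.Finite)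
    (hbip : ∃ S : Set V, ∀ x y, H.Adj x y → (x ∈ S ↔ y ∉ S)) {d : ℕ} (hd0 : 0 < d)
    (hd : ∀ x, (H.neighborSet x).encard ≤ d) :
    ∃ M : Set (V × V), MeasurableSet M ∧ (∀ x y, (x, y) ∈ M → (y, x) ∈ M) ∧
      (∀ x y, (x, y) ∈ M → H.Adj x y) ∧ (∀ x y z, (x, y) ∈ M → (x, z) ∈ M → y = z) ∧
      ∀ x, (H.neighborSet x).encard = d → ∃ y, (x, y) ∈ M := by
  obtain ⟨S, hS⟩ := hbip
  obtain ⟨g, hg, hreach⟩ := exists_measurable_reachable_maps hH hφ hgen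
  obtain ⟨M, hM, hMr, hMP⟩ := exists_borel_solution hH hg hreach hfin
    (fun N A s => (∀ a b, s a b → s b a) ∧ (∀ a b, s a b → A a b) ∧
      (∀ a b c, s a b → s a c → b = c) ∧ ∀ a, {b | A a b}.encard = d → ∃ b, s a b) (by
    intro N e he
    refine exists_matching_of_degree_le (H.comap e) (e ⁻¹' S) (fun a b h => hS _ _ h) hd0
      fun a => le_trans ?_ (hd (e a))
    rw [← he.encard_image]
    refine encard_le_encard ?_
    rintro _ ⟨b, hb, rfl⟩
    exact hb)
  refine ⟨M, hM, ?_, ?_, ?_, ?_⟩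
  · intro x y hxy
    obtain ⟨N, e, -, hr, h, -⟩ := hMP x
    obtain ⟨a, rfl⟩ := (hr x).1 (SimpleGraph.Reachable.refl x)
    obtain ⟨b, rfl⟩ := (hr y).1 (hMr _ _ hxy)
    exact h a b hxy
  · intro x y hxy
    obtain ⟨N, e, -, hr, -, h, -⟩ := hMP x
    obtain ⟨a, rfl⟩ := (hr x).1 (SimpleGraph.Reachable.refl x)
    obtain ⟨b, rfl⟩ := (hr y).1 (hMr _ _ hxy)
    exact h a b hxy
  · intro x y z hxy hxz
    obtain ⟨N, e, -, hr, -, -, h, -⟩ := hMP x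
    obtain ⟨a, rfl⟩ := (hr x).1 (SimpleGraph.Reachable.refl x)
    obtain ⟨b, rfl⟩ := (hr y).1 (hMr _ _ hxy)
    obtain ⟨c, rfl⟩ := (hr z).1 (hMr _ _ hxz)
    rw [h a b c hxy hxz]
  · intro x hx
    obtain ⟨N, e, he, hr, -, -, -, h⟩ := hMP x
    obtain ⟨a, rfl⟩ := (hr x).1 (SimpleGraph.Reachable.refl x)
    obtain ⟨b, hb⟩ := h a (by
      rw [← hx, ← he.encard_image]
      congr 1
      ext y
      constructor
      · rintro ⟨b, hb, rfl⟩
        exact hb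
      · intro hy
        obtain ⟨b, rfl⟩ := (hr y).1 (SimpleGraph.Adj.reachable hy)
        exact ⟨b, hy, rfl⟩)
    exact ⟨_, hb⟩

end ComponentFinite

/-! ### Gluing matchings along levels. -/

/-- The subgraph of `G` spanned by the vertices of level at most `n`. -/
def below {V : Type*} (G : SimpleGraph V) (l : V → ℕ) (n : ℕ) : SimpleGraph V where
  Adj x y := G.Adj x y ∧ l x ≤ n ∧ l y ≤ n
  symm := ⟨fun _ _ h => ⟨h.1.symm, h.2.2, h.2.1⟩⟩
  loopless := ⟨fun _ h => h.1.ne rfl⟩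

/-- Adjacent vertices lie in the same block at neighbouring offsets, or on the two sides of a block
boundary. -/
theorem div_mod_of_near {P m n : ℕ} (hP : 0 < P) (h : m ≤ n + 1) (h' : n ≤ m + 1) :
    (m / P = n / P ∧ m % P ≤ n % P + 1 ∧ n % P ≤ m % P + 1) ∨
      (m / P = n / P + 1 ∧ m % P = 0 ∧ n % P = P - 1) ∨
      (n / P = m / P + 1 ∧ n % P = 0 ∧ m % P = P - 1) := by
  have key : ∀ k, ((k + 1) / P = k / P ∧ (k + 1) % P = k % P + 1) ∨
      ((k + 1) / P = k / P + 1 ∧ (k + 1) % P = 0 ∧ k % P = P - 1) := by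
    intro k
    have h1 := Nat.div_add_mod k P
    have h2 := Nat.mod_lt k hP
    by_cases hk : k % P + 1 < P
    · left
      have : k + 1 = (k % P + 1) + P * (k / P) := by omega
      rw [this, Nat.add_mul_div_left _ _ hP, Nat.add_mul_mod_self_left, Nat.div_eq_of_lt hk,
        Nat.mod_eq_of_lt hk]
      simp
    · right
      have : k + 1 = 0 + P * (k / P + 1) := by rw [Nat.mul_add]; omega
      rw [this, Nat.add_mul_div_left _ _ hP, Nat.add_mul_mod_self_left]
      simp
      omega
  rcases (by omega : m = n ∨ m = n + 1 ∨ n = m + 1) with rfl | rfl | rfl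
  · exact Or.inl ⟨rfl, by omega, by omega⟩
  · rcases key n with h | h
    · exact Or.inl ⟨h.1, by omega, by omega⟩
    · exact Or.inr (Or.inl h)
  · rcases key m with h | h
    · exact Or.inl ⟨h.1.symm, by omega, by omega⟩
    · exact Or.inr (Or.inr h)

section Step

variable {V : Type*} [MeasurableSpace V] [StandardBorelSpace V] {G : SimpleGraph V}

/-- In a bipartite Borel graph of maximum degree at most `d`, exhausted by component finite
subgraphs spanned by levels, all the vertices of degree `d` are covered by two Borel matchings, one
of which only uses edges in a prescribed periodic zone of levels. -/
theorem exists_two_matchings (hG : MeasurableSet {p : V × V | G.Adj p.1 p.2})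
    {φ : ℕ → V → V} (hφ : ∀ k, Measurable (φ k)) (hgen : ∀ x y, G.Adj x y → ∃ k, φ k x = y)
    (hbip : ∃ S : Set V, ∀ x y, G.Adj x y → (x ∈ S ↔ y ∉ S)) {l : V → ℕ} (hl : Measurable l)
    (hlip : ∀ x y, G.Adj x y → l y ≤ l x + 1)
    (hfin : ∀ n x, {y | (below G l n).Reachable x y}.Finite) {d P : ℕ} (hd0 : 0 < d)
    (hP : 4 * d + 8 ≤ P) (hd : ∀ x, (G.neighborSet x).encard ≤ d) :
    ∃ M N : Set (V × V), MeasurableSet M ∧ MeasurableSet N ∧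
      (∀ x y, (x, y) ∈ M → (y, x) ∈ M) ∧ (∀ x y, (x, y) ∈ N → (y, x) ∈ N) ∧
      (∀ x y z, (x, y) ∈ M → (x, z) ∈ M → y = z) ∧ (∀ x y z, (x, y) ∈ N → (x, z) ∈ N → y = z) ∧
      (∀ x y, (x, y) ∈ N → 4 * d ≤ l x % P ∧ l x % P < 4 * d + 4) ∧
      ∀ x, (G.neighborSet x).encard = d → ∃ y, G.Adj x y ∧ ((x, y) ∈ M ∨ (x, y) ∈ N) := by
  classical
  have hP0 : 0 < P := by omega
  have hGb : ∀ n, MeasurableSet {p : V × V | (below G l n).Adj p.1 p.2} := fun n =>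
    hG.inter ((measurableSet_le (hl.comp measurable_fst) measurable_const).inter
      (measurableSet_le (hl.comp measurable_snd) measurable_const))
  have hgenb : ∀ n x y, (below G l n).Adj x y → ∃ k, φ k x = y := fun n x y h => hgen x y h.1
  have hbipb : ∀ n, ∃ S : Set V, ∀ x y, (below G l n).Adj x y → (x ∈ S ↔ y ∉ S) := fun n =>
    hbip.imp fun S hS x y h => hS x y h.1
  choose S hSm hS using fun j =>
    exists_borel_bipartition (hGb (P * (j + 2))) hφ (hgenb _) (hfin _) (hbipb _)
  -- Vertices in blocks up to `j` keep all their neighbours below level `P * (j + 2)`, so `L j`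
  -- covers those of degree `d`.
  choose L hLm hLsymm hLG hLinj hLcov using fun j =>
    exists_borel_matching (hGb (P * (j + 2))) hφ (hgenb _) (hfin _) (hbipb _) hd0
      (fun x => (encard_le_encard fun y hy => hy.1).trans (hd x))
  -- The block of a vertex, and the index of the matching to be followed near a vertex.
  let b : V → ℕ := fun x => l x / P
  let q : V → ℕ := fun x => if l x % P < 4 * d + 2 then b x else b x + 1
  have hb : Measurable b := (measurable_from_top (f := fun n : ℕ => n / P)).comp hl
  have hq : Measurable q := (measurable_from_top
    (f := fun n : ℕ => if n % P < 4 * d + 2 then n / P else n / P + 1)).comp hl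
  -- The bipartitions `S j` need not agree with one another, so `s` is a bipartition only for edges
  -- inside a block.
  let s : Set V := {x | x ∈ S (b x)}
  have hs : MeasurableSet s := by
    have : s = ⋃ j, {x | b x = j} ∩ S j := by
      ext x
      simp [s]
    rw [this]
    exact MeasurableSet.iUnion fun j => (hb (measurableSet_singleton j)).inter (hSm j)
  have near : ∀ v z, G.Adj v z → (b v = b z ∧ l v % P ≤ l z % P + 1 ∧ l z % P ≤ l v % P + 1) ∨
      (b v = b z + 1 ∧ l v % P = 0 ∧ l z % P = P - 1) ∨
      (b z = b v + 1 ∧ l z % P = 0 ∧ l v % P = P - 1) := fun v z h =>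
    div_mod_of_near hP0 (hlip z v h.symm) (hlip v z h)
  have hqcase : ∀ v, (q v = b v ∧ l v % P < 4 * d + 2) ∨ (q v = b v + 1 ∧ 4 * d + 2 ≤ l v % P) := by
    intro v
    simp only [q]
    split_ifs with h
    · exact Or.inl ⟨rfl, h⟩
    · exact Or.inr ⟨rfl, by omega⟩
  have hqadj : ∀ v z, G.Adj v z → q z = b v ∨ q z = b v + 1 := by
    intro v z h
    have h1 := near v z h
    have h2 := hqcase z
    omega
  -- Within a block `q` jumps only at offset `4 * d + 2`, and it does not change across a block
  -- boundary. Neighbours of `v` with different `q` thus straddle this offset, which puts `v` and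
  -- `y` within two levels of it.
  have hzone : ∀ v y y', G.Adj v y → G.Adj v y' → q y ≠ q y' → b v = b y ∧
      (4 * d ≤ l v % P ∧ l v % P < 4 * d + 4) ∧ (4 * d ≤ l y % P ∧ l y % P < 4 * d + 4) := by
    intro v y y' h h' hne
    have h1 := near v y h
    have h2 := near v y' h'
    have h3 := hqcase y
    have h4 := hqcase y'
    omega
  have hbadj : ∀ v z, G.Adj v z → q v ≠ q z → b v = b z := by
    intro v z h hne
    have h1 := near v z h
    have h3 := hqcase v
    have h4 := hqcase z
    omega
  have hlb : ∀ v j, b v ≤ j → l v + 1 ≤ P * (j + 2) := by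
    intro v j hj
    have h1 := Nat.div_add_mod (l v) P
    have h2 := Nat.mod_lt (l v) hP0
    have h3 : P * (l v / P) ≤ P * j := Nat.mul_le_mul_left P hj
    have h4 : P * (j + 2) = P * j + P + P := by ring
    omega
  have hsadj : ∀ v z, G.Adj v z → b v = b z → (v ∈ s ↔ z ∉ s) := by
    intro v z h hvz
    have := hS (b v) v z ⟨h, by have := hlb v _ le_rfl; omega, by
      have := hlb v _ le_rfl
      have := hlip v z h
      omega⟩
    simpa only [s, mem_ofPred_eq, ← hvz] using this
  have hcov : ∀ v j, b v ≤ j → (G.neighborSet v).encard = d → ∃ y, (v, y) ∈ L j := by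
    intro v j hj hv
    refine hLcov j v ?_
    rw [← hv]
    congr 1
    ext z
    refine ⟨fun h => h.1, fun h => ?_⟩
    have h1 := hlb v j hj
    have h2 := hlip v z h
    exact ⟨h, by omega, by omega⟩
  have hLadj : ∀ j x y, (x, y) ∈ L j → G.Adj x y := fun j x y h => (hLG j x y h).1
  -- The endpoint in `s` decides which matching is followed. Hence a vertex in `s` follows a single
  -- matching; only vertices outside `s` can meet a conflict.
  let idx : V → V → ℕ := fun x y => if x ∈ s then q x else q y
  have hidx_symm : ∀ x y, G.Adj x y → idx x y = idx y x := by
    intro x y h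
    by_cases hxy : q x = q y
    · simp only [idx, hxy]
      split_ifs <;> rfl
    · have := hsadj x y h (hbadj x y h hxy)
      simp only [idx]
      split_ifs <;> first | rfl | tauto
  let M₀ : Set (V × V) := {p | p ∈ L (idx p.1 p.2)}
  -- A vertex `v ∉ s` is in conflict if its partners in `L (b v)` and `L (b v + 1)` have different
  -- `q`; it then has two `M₀`-edges or none. Both cases are cured by putting its `L (b v)`-edge
  -- into `N`: this removes one of the two edges, or supplies the missing one.
  let T : Set (V × V) := {p | p.1 ∈ s ∧ p.2 ∉ s ∧ p ∈ L (b p.2) ∧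
    ∃ x', (x', p.2) ∈ L (b p.2 + 1) ∧ q p.1 ≠ q x'}
  let N : Set (V × V) := {p | p ∈ T ∨ p.swap ∈ T}
  have hM₀m : MeasurableSet M₀ := by
    have : M₀ = ⋃ j, {p | idx p.1 p.2 = j} ∩ L j := by
      ext x
      simp [M₀]
    rw [this]
    refine MeasurableSet.iUnion fun j => MeasurableSet.inter ?_ (hLm j)
    have hi : Measurable fun p : V × V => idx p.1 p.2 :=
      Measurable.ite (measurable_fst hs) (hq.comp measurable_fst) (hq.comp measurable_snd)
    exact hi (measurableSet_singleton j)
  have hTm : MeasurableSet T := by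
    have : T = ⋃ (j : ℕ) (k : ℕ), {p : V × V | p.1 ∈ s} ∩ ({p | p.2 ∉ s} ∩ ({p | b p.2 = j} ∩
        (L j ∩ ({p | (φ k p.2, p.2) ∈ L (j + 1)} ∩ {p | q p.1 = q (φ k p.2)}ᶜ)))) := by
      ext ⟨x, y⟩
      simp only [T, mem_iUnion, mem_inter_iff, mem_ofPred_eq, mem_compl_iff]
      constructor
      · rintro ⟨h1, h2, h3, x', h4, h5⟩
        obtain ⟨k, rfl⟩ := hgen y x' (hLadj _ _ _ h4).symm
        exact ⟨b y, k, h1, h2, rfl, h3, h4, h5⟩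
      · rintro ⟨j, k, h1, h2, rfl, h3, h4, h5⟩
        exact ⟨h1, h2, h3, _, h4, h5⟩
    rw [this]
    refine MeasurableSet.iUnion fun j => MeasurableSet.iUnion fun k =>
      (measurable_fst hs).inter ((measurable_snd hs).compl.inter
        (((hb.comp measurable_snd) (measurableSet_singleton j)).inter ((hLm j).inter
          (MeasurableSet.inter ?_ ?_))))
    · exact (((hφ k).comp measurable_snd).prodMk measurable_snd) (hLm (j + 1))
    · exact (measurableSet_eq_fun (hq.comp measurable_fst)
        (hq.comp ((hφ k).comp measurable_snd))).compl
  have hNm : MeasurableSet N := hTm.union (measurable_swap hTm)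
  have hNsymm : ∀ x y, (x, y) ∈ N → (y, x) ∈ N := fun x y => Or.symm
  have hTzone : ∀ x y, (x, y) ∈ T → b y = b x ∧
      (4 * d ≤ l y % P ∧ l y % P < 4 * d + 4) ∧ (4 * d ≤ l x % P ∧ l x % P < 4 * d + 4) := by
    rintro x y ⟨-, -, h, x', h', hne⟩
    exact hzone y x x' (hLadj _ _ _ h).symm (hLadj _ _ _ h').symm hne
  refine ⟨M₀ \ N, N, hM₀m.diff hNm, hNm, ?_, hNsymm, ?_, ?_, ?_, ?_⟩
  · rintro x y ⟨h, hn⟩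
    refine ⟨?_, fun h' => hn (hNsymm _ _ h')⟩
    change (y, x) ∈ L (idx y x)
    rw [← hidx_symm x y (hLadj _ _ _ h)]
    exact hLsymm _ _ _ h
  · have key : ∀ v y y', (v, y) ∈ M₀ \ N → (v, y') ∈ M₀ \ N → idx v y = b v →
        idx v y' = b v + 1 → False := by
      rintro v y y' ⟨h, hn⟩ ⟨h', hn'⟩ hi hi'
      have hvs : v ∉ s := by
        intro hvs
        simp only [idx, if_pos hvs] at hi hi'
        omega
      change (v, y) ∈ L (idx v y) at h
      change (v, y') ∈ L (idx v y') at h'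
      rw [hi] at h
      rw [hi'] at h'
      simp only [idx, if_neg hvs] at hi hi'
      have hne : q y ≠ q y' := by omega
      have hz := hzone v y y' (hLadj _ _ _ h) (hLadj _ _ _ h') hne
      have hys : y ∈ s := by
        by_contra hys
        exact hvs ((hsadj v y (hLadj _ _ _ h) hz.1).2 hys)
      exact hn (Or.inr ⟨hys, hvs, hLsymm _ _ _ h, y', hLsymm _ _ _ h', hne⟩)
    intro v y y' h h'
    by_cases hi : idx v y = idx v y'
    · have h1 : (v, y) ∈ L (idx v y) := h.1
      have h2 : (v, y') ∈ L (idx v y') := h'.1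
      rw [← hi] at h2
      exact hLinj _ _ _ _ h1 h2
    · exfalso
      have hvs : v ∉ s := by
        intro hvs
        simp only [idx, if_pos hvs] at hi
        exact hi trivial
      have h1 := hqadj v y (hLadj _ _ _ h.1)
      have h2 := hqadj v y' (hLadj _ _ _ h'.1)
      have hiy : idx v y = q y := by simp only [idx, if_neg hvs]
      have hiy' : idx v y' = q y' := by simp only [idx, if_neg hvs]
      rw [← hiy] at h1
      rw [← hiy'] at h2
      rcases h1 with h1 | h1 <;> rcases h2 with h2 | h2
      · exact hi (h1.trans h2.symm)
      · exact key v y y' h h' h1 h2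
      · exact key v y' y h' h h2 h1
      · exact hi (h1.trans h2.symm)
  · rintro v y z (h | h) (h' | h')
    · have h1 := h.2.2.1
      have h2 := h'.2.2.1
      dsimp only at h1 h2
      rw [(hTzone _ _ h).1] at h1
      rw [(hTzone _ _ h').1] at h2
      exact hLinj _ _ _ _ h1 h2
    · exact absurd h.1 h'.2.1
    · exact absurd h'.1 h.2.1
    · exact hLinj _ _ _ _ (hLsymm _ _ _ h.2.2.1) (hLsymm _ _ _ h'.2.2.1)
  · rintro x y (h | h)
    · exact (hTzone _ _ h).2.2
    · exact (hTzone _ _ h).2.1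
  · intro v hv
    suffices ∃ y, (v, y) ∈ M₀ ∨ (v, y) ∈ T ∨ (y, v) ∈ T by
      obtain ⟨y, h | h | h⟩ := this
      · by_cases hn : (v, y) ∈ N
        · exact ⟨y, hLadj _ _ _ h, Or.inr hn⟩
        · exact ⟨y, hLadj _ _ _ h, Or.inl ⟨h, hn⟩⟩
      · exact ⟨y, hLadj _ _ _ h.2.2.1, Or.inr (Or.inl h)⟩
      · exact ⟨y, (hLadj _ _ _ h.2.2.1).symm, Or.inr (Or.inr h)⟩
    by_cases hvs : v ∈ s
    · have hqb := hqcase v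
      obtain ⟨y, hy⟩ := hcov v (q v) (by omega) hv
      refine ⟨y, Or.inl ?_⟩
      change (v, y) ∈ L (idx v y)
      simpa only [idx, if_pos hvs] using hy
    -- If neither partner follows the matching that joins it to `v`, then `q y = b v + 1` and `q y'
    -- = b v`: the conflict for which the edge to `y` lies in `T`.
    · obtain ⟨y, hy⟩ := hcov v (b v) le_rfl hv
      obtain ⟨y', hy'⟩ := hcov v (b v + 1) (Nat.le_succ _) hv
      have hM : ∀ z, (v, z) ∈ L (q z) → (v, z) ∈ M₀ := by
        intro z hz
        change (v, z) ∈ L (idx v z)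
        simpa only [idx, if_neg hvs] using hz
      by_cases h1 : q y = b v
      · exact ⟨y, Or.inl (hM y (h1 ▸ hy))⟩
      by_cases h2 : q y' = b v + 1
      · exact ⟨y', Or.inl (hM y' (h2 ▸ hy'))⟩
      have h3 := hqadj v y (hLadj _ _ _ hy)
      have h4 := hqadj v y' (hLadj _ _ _ hy')
      have hne : q y ≠ q y' := by omega
      have hz := hzone v y y' (hLadj _ _ _ hy) (hLadj _ _ _ hy') hne
      have hys : y ∈ s := by
        by_contra hys
        exact hvs ((hsadj v y (hLadj _ _ _ hy) hz.1).2 hys)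
      exact ⟨y, Or.inr (Or.inr ⟨hys, hvs, hLsymm _ _ _ hy, y', hLsymm _ _ _ hy', hne⟩)⟩

end Step

/-! ### Induction on the degree. -/

/-- The subgraph of `G` obtained by deleting the edges in a symmetric set of pairs. -/
def deletePairs {V : Type*} (G : SimpleGraph V) (M : Set (V × V))
    (hM : ∀ x y, (x, y) ∈ M → (y, x) ∈ M) : SimpleGraph V where
  Adj x y := G.Adj x y ∧ (x, y) ∉ M
  symm := ⟨fun _ _ h => ⟨h.1.symm, fun h' => h.2 (hM _ _ h')⟩⟩
  loopless := ⟨fun _ h => h.1.ne rfl⟩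

/-- A bipartite Borel graph of maximum degree at most `d`, exhausted by component finite subgraphs
spanned by levels, has a Borel proper edge colouring with `d + 1` colours. -/
theorem exists_borel_edgeColoring_of_levels {V : Type*} [MeasurableSpace V] [StandardBorelSpace V]
    {φ : ℕ → V → V} (hφ : ∀ k, Measurable (φ k)) {l : V → ℕ} (hl : Measurable l) {P : ℕ} (d : ℕ)
    (hP : 4 * d + 8 ≤ P) :
    ∀ {G : SimpleGraph V}, MeasurableSet {p : V × V | G.Adj p.1 p.2} →
      (∀ x y, G.Adj x y → ∃ k, φ k x = y) →
      (∃ S : Set V, ∀ x y, G.Adj x y → (x ∈ S ↔ y ∉ S)) →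
      (∀ x y, G.Adj x y → l y ≤ l x + 1) →
      (∀ n x, {y | (below G l n).Reachable x y}.Finite) →
      (∀ x, (G.neighborSet x).encard ≤ d) →
      ∃ c : V → V → ℕ, Measurable (fun p : V × V => c p.1 p.2) ∧ (∀ x y, c x y = c y x) ∧
        (∀ x y, c x y ≤ d) ∧
        (∀ x y z, G.Adj x y → G.Adj x z → c x y = c x z → y = z) ∧
        ∀ x y, G.Adj x y → c x y = 0 → l x % P < 4 * d + 4 := by
  classical
  induction d with
  | zero =>
    intro G _ _ _ _ _ hd
    have hno : ∀ x y, ¬ G.Adj x y := by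
      intro x y h
      have h0 : G.neighborSet x = ∅ := by simpa using hd x
      exact (h0 ▸ (show y ∈ G.neighborSet x from h) : y ∈ (∅ : Set V))
    exact ⟨fun _ _ => 0, measurable_const, fun _ _ => rfl, fun _ _ => le_rfl,
      fun x y _ h => absurd h (hno x y), fun x y h => absurd h (hno x y)⟩
  | succ d ih =>
    intro G hG hgen hbip hlip hfin hd
    obtain ⟨M, N, hM, hN, hMs, hNs, hMi, hNi, hNz, hcov⟩ :=
      exists_two_matchings hG hφ hgen hbip hl hlip hfin (Nat.succ_pos d) hP hd
    let G' := deletePairs G (M ∪ N) (fun x y h => h.imp (hMs x y) (hNs x y))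
    have hmono : ∀ n, below G' l n ≤ below G l n := fun n x y h => ⟨h.1.1, h.2⟩
    have hd' : ∀ x, (G'.neighborSet x).encard ≤ d := by
      intro x
      have hsub : G'.neighborSet x ⊆ G.neighborSet x := fun y h => h.1
      rcases (hd x).lt_or_eq with h | h
      · have := (encard_le_encard hsub).trans_lt h
        exact Order.le_of_lt_add_one (by exact_mod_cast this)
      · obtain ⟨y, hxy, hy⟩ := hcov x h
        have hsub' : G'.neighborSet x ⊆ G.neighborSet x \ {y} := by
          intro z hz
          refine ⟨hz.1, ?_⟩
          rintro rfl
          exact hz.2 hy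
        refine (encard_le_encard hsub').trans ?_
        have h1 := encard_sdiff_singleton_add_one (show y ∈ G.neighborSet x from hxy)
        rw [h] at h1
        push_cast at h1
        exact (WithTop.add_right_inj (by simp : (1 : ℕ∞) ≠ ⊤)).1 h1 |>.le
    obtain ⟨c, hc, hcs, hcd, hcp, hcz⟩ := ih (by omega) (G := G') (hG.inter (hM.union hN).compl)
      (fun x y h => hgen x y h.1) (hbip.imp fun S hS x y h => hS x y h.1)
      (fun x y h => hlip x y h.1)
      (fun n x => (hfin n x).subset fun y hy => SimpleGraph.Reachable.mono (hmono n) hy) hd'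
    refine ⟨fun x y => if (x, y) ∈ N then 0 else if (x, y) ∈ M then d + 1 else c x y,
      Measurable.ite hN measurable_const (Measurable.ite hM measurable_const hc), ?_, ?_, ?_, ?_⟩
    · intro x y
      have h1 : (x, y) ∈ N ↔ (y, x) ∈ N := ⟨hNs x y, hNs y x⟩
      have h2 : (x, y) ∈ M ↔ (y, x) ∈ M := ⟨hMs x y, hMs y x⟩
      simp only [h1, h2, hcs x y]
    · intro x y
      have := hcd x y
      dsimp only
      split_ifs <;> omega
    · have hG' : ∀ x y, G.Adj x y → (x, y) ∉ N → (x, y) ∉ M → G'.Adj x y :=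
        fun x y h h1 h2 => ⟨h, fun h3 => h3.elim h2 h1⟩
      -- Inductively, colour 0 occurs only at offsets below `4 * d + 4`, where the zone of the
      -- present `N` begins.
      have hzero : ∀ x y z, (x, y) ∈ N → G.Adj x z → (x, z) ∉ N → (x, z) ∉ M → 0 ≠ c x z := by
        intro x y z h1 h2 h3 h4 h0
        have := hcz x z (hG' x z h2 h3 h4) h0.symm
        have := hNz x y h1
        omega
      intro x y z hxy hxz h
      have hy := hcd x y
      have hz := hcd x z
      dsimp only at h
      by_cases h1 : (x, y) ∈ N <;> by_cases h2 : (x, z) ∈ N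
      · exact hNi _ _ _ h1 h2
      · by_cases h3 : (x, z) ∈ M
        · simp [h1, h2, h3] at h
        · simp only [h1, h2, h3, if_true, if_false] at h
          exact absurd h (hzero x y z h1 hxz h2 h3)
      · by_cases h3 : (x, y) ∈ M
        · simp [h1, h2, h3] at h
        · simp only [h1, h2, h3, if_true, if_false] at h
          exact absurd h.symm (hzero x z y h2 hxy h1 h3)
      · by_cases h3 : (x, y) ∈ M <;> by_cases h4 : (x, z) ∈ M <;>
          simp only [h1, h2, h3, h4, if_true, if_false] at h
        · exact hMi _ _ _ h3 h4
        · omega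
        · omega
        · exact hcp x y z (hG' x y hxy h1 h3) (hG' x z hxz h2 h4) h
    · intro x y hxy h
      dsimp only at h
      split_ifs at h with h1 h2
      · have := hNz x y h1
        omega
      · have := hcz x y ⟨hxy, fun h3 => h3.elim h2 h1⟩ h
        omega

/-! ### Level functions by Borel–Cantelli. -/

/-- The subgraph of `G` consisting of the edges within `C`, with the same vertices. -/
def restrict {V : Type*} (G : SimpleGraph V) (C : Set V) : SimpleGraph V where
  Adj x y := G.Adj x y ∧ x ∈ C ∧ y ∈ C
  symm := ⟨fun _ _ h => ⟨h.1.symm, h.2.2, h.2.1⟩⟩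
  loopless := ⟨fun _ h => h.1.ne rfl⟩

/-- A locally finite hyperfinite graph admits, on an invariant conull Borel set, a Borel level
function that changes by at most one along edges and whose sublevel sets span component finite
graphs. -/
theorem exists_levels {V : Type*} [MeasurableSpace V] [StandardBorelSpace V] (μ : Measure V)
    [IsFiniteMeasure μ] {G : SimpleGraph V} (hG : MeasurableSet {p : V × V | G.Adj p.1 p.2})
    {φ : ℕ → V → V} (hφ : ∀ k, Measurable (φ k)) (hgen : ∀ x y, G.Adj x y → ∃ k, φ k x = y)
    (hloc : ∀ x, (G.neighborSet x).Finite) {H : ℕ → SimpleGraph V} (hmono : Monotone H)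
    (hH : ∀ n, MeasurableSet {p : V × V | (H n).Adj p.1 p.2})
    (hfin : ∀ n x, {y | (H n).Reachable x y}.Finite)
    (hsup : ∀ x y, G.Adj x y ↔ ∃ n, (H n).Adj x y) :
    ∃ (C : Set V) (l : V → ℕ), MeasurableSet C ∧ (∀ x y, G.Adj x y → x ∈ C → y ∈ C) ∧ μ Cᶜ = 0 ∧
      Measurable l ∧ (∀ x y, (restrict G C).Adj x y → l y ≤ l x + 1) ∧
      ∀ n x, {y | (below (restrict G C) l n).Reachable x y}.Finite := by
  classical
  -- Points whose `H i`-component has an incident edge of `G` not yet in `H j`. Finite components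
  -- and local finiteness make these sets decrease to the empty set as `j` grows.
  let bad : ℕ → ℕ → Set V := fun i j =>
    {x | ∃ y z, (H i).Reachable x y ∧ G.Adj y z ∧ ¬ (H j).Adj y z}
  have hbadm : ∀ i j, MeasurableSet (bad i j) := by
    intro i j
    obtain ⟨g, hg, hreach⟩ := exists_measurable_reachable_maps (hH i) hφ
      fun x y h => hgen x y ((hsup x y).2 ⟨i, h⟩)
    have : bad i j = ⋃ (n : ℕ) (k : ℕ), (fun x => (g n x, φ k (g n x))) ⁻¹'
        ({p | G.Adj p.1 p.2} \ {p | (H j).Adj p.1 p.2}) := by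
      ext x
      simp only [bad, mem_iUnion, mem_preimage, mem_sdiff, mem_ofPred_eq]
      constructor
      · rintro ⟨y, z, h1, h2, h3⟩
        obtain ⟨n, rfl⟩ := (hreach x y).1 h1
        obtain ⟨k, rfl⟩ := hgen _ z h2
        exact ⟨n, k, h2, h3⟩
      · rintro ⟨n, k, h2, h3⟩
        exact ⟨_, _, (hreach _ _).2 ⟨n, rfl⟩, h2, h3⟩
    rw [this]
    exact MeasurableSet.iUnion fun n => MeasurableSet.iUnion fun k =>
      ((hg n).prodMk ((hφ k).comp (hg n))) (hG.diff (hH j))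
  have hbadanti : ∀ i, Antitone (bad i) := by
    rintro i j j' hj x ⟨y, z, h1, h2, h3⟩
    exact ⟨y, z, h1, h2, fun h => h3 (hmono hj h)⟩
  have hbadempty : ∀ i, ⋂ j, bad i j = ∅ := by
    intro i
    rw [eq_empty_iff_forall_notMem]
    intro x hx
    have hF : {p : V × V | (H i).Reachable x p.1 ∧ G.Adj p.1 p.2}.Finite := by
      refine ((hfin i x).biUnion fun y _ => (hloc y).image fun z => (y, z)).subset ?_
      rintro ⟨y, z⟩ ⟨h1, h2⟩
      exact mem_biUnion (show y ∈ {y | (H i).Reachable x y} from h1) ⟨z, h2, rfl⟩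
    choose! t ht using fun p : V × V => (hsup p.1 p.2).1
    obtain ⟨j, hj⟩ := (hF.image t).bddAbove
    obtain ⟨y, z, h1, h2, h3⟩ := mem_iInter.1 hx j
    have hyz : t (y, z) ≤ j := hj ⟨(y, z), ⟨h1, h2⟩, rfl⟩
    exact h3 (hmono hyz (ht (y, z) h2))
  have hsmall : ∀ i n : ℕ, ∃ j ≥ i, μ (bad i j) ≤ (2⁻¹ : ENNReal) ^ n := by
    intro i n
    have hlim := tendsto_measure_iInter_atTop (μ := μ) (s := bad i)
      (fun j => (hbadm i j).nullMeasurableSet) (hbadanti i) ⟨0, measure_ne_top _ _⟩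
    rw [hbadempty, measure_empty] at hlim
    have hpos : (0 : ENNReal) < 2⁻¹ ^ n := by
      refine ENNReal.pow_pos ?_ n
      simp
    obtain ⟨j, h1, h2⟩ := ((hlim.eventually (ge_mem_nhds hpos)).and
      (Filter.eventually_ge_atTop i)).exists
    exact ⟨j, h2, h1⟩
  choose J hJ hJμ using hsmall
  let m : ℕ → ℕ := fun n => Nat.rec 0 (fun n k => J k n) n
  have hm : Monotone m := monotone_nat_of_le_succ fun n => hJ (m n) n
  have hmμ : ∀ n, μ (bad (m n) (m (n + 1))) ≤ (2⁻¹ : ENNReal) ^ n := fun n => hJμ (m n) n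
  let W : ℕ → Set V := fun n => {x | ∀ k ≥ n, x ∉ bad (m k) (m (k + 1))}
  have hWm : ∀ n, MeasurableSet (W n) := by
    intro n
    have : W n = ⋂ (k : ℕ) (_ : k ≥ n), (bad (m k) (m (k + 1)))ᶜ := by
      ext x
      simp [W]
    rw [this]
    exact MeasurableSet.iInter fun k => MeasurableSet.iInter fun _ => (hbadm _ _).compl
  have hWmono : Monotone W := fun a b hab x hx k hk => hx k (hab.trans hk)
  -- Whether a point is bad depends only on its component. Together with `hWadj` this makes the
  -- union of the `W n` invariant under `G`, with no invariance assumed of `μ`.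
  have hWinv : ∀ n x y, (H (m n)).Adj x y → x ∈ W n → y ∈ W n := by
    rintro n x y hxy hx k hk ⟨y', z, h1, h2, h3⟩
    exact hx k hk ⟨y', z, ((hmono (hm hk)) hxy).reachable.trans h1, h2, h3⟩
  have hWadj : ∀ n x z, G.Adj x z → x ∈ W n → (H (m (n + 1))).Adj x z := by
    intro n x z hxz hx
    by_contra h
    exact hx n le_rfl ⟨x, z, SimpleGraph.Reachable.refl x, hxz, h⟩
  have hWstep : ∀ n x z, G.Adj x z → x ∈ W n → z ∈ W (n + 1) := fun n x z hxz hx =>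
    hWinv _ _ _ (hWadj n x z hxz hx) (hWmono n.le_succ hx)
  let C : Set V := ⋃ n, W n
  have hC : MeasurableSet C := MeasurableSet.iUnion hWm
  -- The second alternative only makes `l` total, with value 0 off `C`.
  have hex : ∀ x, ∃ n, x ∈ W n ∨ x ∉ C := by
    intro x
    by_cases hx : x ∈ C
    · obtain ⟨n, hn⟩ := mem_iUnion.1 hx
      exact ⟨n, Or.inl hn⟩
    · exact ⟨0, Or.inr hx⟩
  let l : V → ℕ := fun x => Nat.find (hex x)
  have hlW : ∀ x ∈ C, x ∈ W (l x) := fun x hx =>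
    (Nat.find_spec (hex x)).resolve_right fun h => h hx
  refine ⟨C, l, hC, ?_, ?_, ?_, ?_, ?_⟩
  · intro x y hxy hx
    obtain ⟨n, hn⟩ := mem_iUnion.1 hx
    exact mem_iUnion.2 ⟨n + 1, hWstep n x y hxy hn⟩
  · have hsum : ∑' n, μ (bad (m n) (m (n + 1))) ≠ ⊤ := by
      refine ne_top_of_le_ne_top ?_ (ENNReal.tsum_le_tsum hmμ)
      rw [ENNReal.tsum_geometric]
      simp
    refine measure_mono_null ?_ (ae_iff.1 (ae_eventually_notMem hsum))
    intro x hx h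
    obtain ⟨n, hn⟩ := Filter.eventually_atTop.1 h
    exact hx (mem_iUnion.2 ⟨n, hn⟩)
  · exact measurable_find hex fun n => (hWm n).union hC.compl
  · rintro x y ⟨hxy, hx, -⟩
    exact Nat.find_min' (hex y) (Or.inl (hWstep _ x y hxy (hlW x hx)))
  · intro n x
    have hle : below (restrict G C) l n ≤ H (m (n + 1)) := by
      rintro y z ⟨⟨hyz, hy, -⟩, hn, -⟩
      exact hWadj n y z hyz (hWmono hn (hlW y hy))
    exact (hfin _ x).subset fun y hy => SimpleGraph.Reachable.mono hle hy

/-! ### Passage to induced subgraphs and conclusion. -/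

/-- Reachability in the image of a graph under an embedding. -/
theorem exists_reachable_of_reachable_map {V W : Type*} {f : V ↪ W} {K : SimpleGraph V} {a : V}
    {y : W} (h : (K.map f).Reachable (f a) y) : ∃ b, f b = y ∧ K.Reachable a b := by
  obtain ⟨p⟩ := h
  generalize hx : f a = x at p
  induction p generalizing a with
  | nil => exact ⟨a, hx, SimpleGraph.Reachable.refl a⟩
  | cons h p ih =>
    obtain ⟨u, v, huv, hu, hv⟩ := (SimpleGraph.map_adj f K _ _).1 h
    obtain ⟨b, hb, hr⟩ := ih hv
    obtain rfl : u = a := f.injective (hu.trans hx.symm)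
    exact ⟨b, hb, huv.reachable.trans hr⟩

theorem IsComponentFinite.finite_reachable_map {V W : Type*} (f : V ↪ W) {K : SimpleGraph V}
    (hK : IsComponentFinite K) (x : W) : {y | (K.map f).Reachable x y}.Finite := by
  by_cases hx : ∃ a, f a = x
  · obtain ⟨a, rfl⟩ := hx
    refine ((hK (K.connectedComponentMk a)).image f).subset fun y hy => ?_
    obtain ⟨b, rfl, hb⟩ := exists_reachable_of_reachable_map hy
    exact ⟨b, (SimpleGraph.ConnectedComponent.eq.2 hb.symm), rfl⟩
  · refine (finite_singleton x).subset ?_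
    rintro y ⟨p⟩
    cases p with
    | nil => rfl
    | cons h p =>
      obtain ⟨u, v, -, hu, -⟩ := (SimpleGraph.map_adj f K _ _).1 h
      exact absurd ⟨u, hu⟩ hx

theorem IsComponentFinite.neighborSet_finite {V : Type*} {H : SimpleGraph V}
    (hH : ∀ x, {y | H.Reachable x y}.Finite) (x : V) : (H.neighborSet x).Finite :=
  (hH x).subset fun _ hy => SimpleGraph.Adj.reachable hy

/-- A symmetric Borel function on pairs of vertices which is injective on the edges at each vertex
is a Borel proper edge colouring. -/
theorem borelEdgeColorable_of_symmetric {W Y : Type u} [MeasurableSpace W] [MeasurableSpace Y]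
    [StandardBorelSpace Y] {K : SimpleGraph W} {κ : Cardinal.{u}} (hY : #Y ≤ κ) (c : W → W → Y)
    (hc : Measurable fun p : W × W => c p.1 p.2) (hsymm : ∀ x y, c x y = c y x)
    (hproper : ∀ x y z, K.Adj x y → K.Adj x z → c x y = c x z → y = z) :
    BorelEdgeColorable K κ := by
  let col : K.lineGraph.Coloring Y := SimpleGraph.Coloring.mk
    (fun e => Sym2.lift ⟨c, hsymm⟩ e.1) (by
      intro e₁ e₂ h heq
      obtain ⟨hne, v, h1, h2⟩ := SimpleGraph.lineGraph_adj_iff_exists.1 h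
      obtain ⟨e₁, he₁⟩ := e₁
      obtain ⟨e₂, he₂⟩ := e₂
      obtain ⟨y, rfl⟩ := Sym2.mem_iff_exists.1 h1
      obtain ⟨z, rfl⟩ := Sym2.mem_iff_exists.1 h2
      refine hne (Subtype.ext ?_)
      exact congrArg (fun t => s(v, t)) (hproper v y z he₁ he₂ heq))
  exact ⟨Y, inferInstance, inferInstance, hY, col, hc.comp measurable_subtype_coe⟩

/-- A symmetric Borel colouring by natural numbers of the edges of `G` within a set restricts to a
Borel proper edge colouring of the induced subgraph. -/
theorem borelEdgeColorable_induce {X Y : Type u} [MeasurableSpace X] {G : SimpleGraph X}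
    {C : Set X} {κ : Cardinal.{u}} {c : X → X → ℕ} (hc : Measurable fun p : X × X => c p.1 p.2)
    (hsymm : ∀ x y, c x y = c y x)
    (hproper : ∀ x y z, (restrict G C).Adj x y → (restrict G C).Adj x z → c x y = c x z → y = z)
    [Countable Y] (hY : #Y ≤ κ) (f : ℕ → Y)
    (hf : ∀ x y z, f (c x y) = f (c x z) → c x y = c x z) :
    BorelEdgeColorable (G.induce C) κ := by
  let : MeasurableSpace Y := ⊤
  refine borelEdgeColorable_of_symmetric hY (fun x y => f (c x y)) ?_ (fun x y => ?_) ?_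
  · exact (measurable_from_top (f := f)).comp (hc.comp
      ((measurable_subtype_coe.comp measurable_fst).prodMk
        (measurable_subtype_coe.comp measurable_snd)))
  · rw [hsymm]
  · intro x y z hxy hxz h
    exact Subtype.ext (hproper x y z ⟨hxy, x.2, y.2⟩ ⟨hxz, x.2, z.2⟩ (hf _ _ _ h))

theorem exists_borelEdgeColorable_induce {X : Type u} [MeasurableSpace X] [StandardBorelSpace X]
    (μ : Measure X) [IsFiniteMeasure μ] {G : SimpleGraph X} (hG : IsBorel G)
    (hbip : G.IsBipartite) (hhyp : IsMuHyperfinite G μ) :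
    ∃ C : Set X, IsInvariantConull G μ C ∧
      BorelEdgeColorable (G.induce C) (maxDegree G + 1) := by
  obtain ⟨C₀, ⟨hC₀, hinv, hnull⟩, K, hKmono, hKb, hKfin, hKsup⟩ := hhyp
  let f : C₀ ↪ X := Embedding.subtype _
  -- Pushing the witnesses forward to `X` keeps the vertex space fixed; the added vertices are
  -- isolated.
  let H : ℕ → SimpleGraph X := fun n => (K n).map f
  have hmono : Monotone H := by
    intro a b hab x y h
    obtain ⟨u, v, huv, hu, hv⟩ := (SimpleGraph.map_adj f _ _ _).1 h
    exact (SimpleGraph.map_adj f _ _ _).2 ⟨u, v, hKmono hab huv, hu, hv⟩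
  have hH : ∀ n, MeasurableSet {p : X × X | (H n).Adj p.1 p.2} := by
    intro n
    have hemb := (MeasurableEmbedding.subtype_coe hC₀).prodMap (MeasurableEmbedding.subtype_coe hC₀)
    have : {p : X × X | (H n).Adj p.1 p.2} =
        Prod.map Subtype.val Subtype.val '' {p : C₀ × C₀ | (K n).Adj p.1 p.2} := by
      ext ⟨x, y⟩
      constructor
      · intro h
        obtain ⟨u, v, huv, rfl, rfl⟩ := (SimpleGraph.map_adj f _ _ _).1 h
        exact ⟨(u, v), huv, rfl⟩
      · rintro ⟨⟨u, v⟩, huv, h⟩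
        obtain ⟨rfl, rfl⟩ := Prod.mk.inj h
        exact (SimpleGraph.map_adj f _ _ _).2 ⟨u, v, huv, rfl, rfl⟩
    rw [this]
    exact hemb.measurableSet_image.2 (hKb n)
  have hfin : ∀ n x, {y | (H n).Reachable x y}.Finite := fun n => (hKfin n).finite_reachable_map f
  have hsup : ∀ x y, (restrict G C₀).Adj x y ↔ ∃ n, (H n).Adj x y := by
    intro x y
    have hK : ∀ u v : C₀, G.Adj u v ↔ ∃ n, (K n).Adj u v := fun u v => by
      rw [← SimpleGraph.iSup_adj, hKsup]
      rfl
    constructor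
    · rintro ⟨h, hx, hy⟩
      obtain ⟨n, hn⟩ := (hK ⟨x, hx⟩ ⟨y, hy⟩).1 h
      exact ⟨n, (SimpleGraph.map_adj f _ _ _).2 ⟨_, _, hn, rfl, rfl⟩⟩
    · rintro ⟨n, hn⟩
      obtain ⟨u, v, huv, rfl, rfl⟩ := (SimpleGraph.map_adj f _ _ _).1 hn
      exact ⟨(hK u v).2 ⟨n, huv⟩, u.2, v.2⟩
  have hrestrict : ∀ {G : SimpleGraph X} {C : Set X}, IsBorel G → MeasurableSet C →
      MeasurableSet {p : X × X | (restrict G C).Adj p.1 p.2} := fun hG hC =>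
    MeasurableSet.inter hG ((measurable_fst hC).inter (measurable_snd hC))
  have hG₀ := hrestrict hG hC₀
  obtain ⟨Q, hQm, hQf, hQcov⟩ : ∃ Q : ℕ → Set (X × X), (∀ n, MeasurableSet (Q n)) ∧
      (∀ n x y z, (x, y) ∈ Q n → (x, z) ∈ Q n → y = z) ∧
      ∀ x y, (restrict G C₀).Adj x y → ∃ n, (x, y) ∈ Q n := by
    choose Q hQm hQf hQ using fun n => exists_functional_cover_of_finite (hH n)
      (IsComponentFinite.neighborSet_finite (hfin n))
    refine ⟨fun k => Q k.unpair.1 k.unpair.2, fun k => hQm _ _, fun k => hQf _ _, ?_⟩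
    intro x y h
    obtain ⟨n, hn⟩ := (hsup x y).1 h
    have hxy : (x, y) ∈ ⋃ k, Q n k := hQ n ▸ hn
    obtain ⟨k, hk⟩ := mem_iUnion.1 hxy
    exact ⟨Nat.pair n k, by simpa using hk⟩
  rcases lt_or_ge (maxDegree G) ℵ₀ with hΔ | hΔ
  · obtain ⟨d, hd⟩ := Cardinal.lt_aleph0.1 hΔ
    have hdeg : ∀ x, (G.neighborSet x).encard ≤ d := by
      intro x
      have : #(G.neighborSet x) ≤ d := by
        rw [← hd]
        exact le_ciSup (f := fun x : X => #(G.neighborSet x)) Cardinal.bddAbove_of_small x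
      exact Cardinal.toENat_le_natCast.2 this
    choose φ hφ hφQ using fun n => exists_measurable_extension (hQm n) (hQf n)
    have hgen : ∀ x y, (restrict G C₀).Adj x y → ∃ k, φ k x = y := fun x y h =>
      (hQcov x y h).imp fun n hn => hφQ n x y hn
    have hloc : ∀ x, ((restrict G C₀).neighborSet x).Finite := fun x =>
      (finite_of_encard_le_coe (hdeg x)).subset fun y hy => hy.1
    obtain ⟨C, l, hC, hCinv, hCnull, hl, hlip, hlfin⟩ :=
      exists_levels μ hG₀ hφ hgen hloc hmono hH hfin hsup
    obtain ⟨c, hc, hcs, hcd, hcp, -⟩ := exists_borel_edgeColoring_of_levels hφ hl d le_rfl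
      (hrestrict hG₀ hC) (fun x y h => hgen x y h.1) (by
        obtain ⟨col⟩ := hbip
        refine ⟨{x | col x = 0}, fun x y h => ?_⟩
        have := col.valid h.1.1
        simp only [mem_ofPred_eq]
        omega) hlip hlfin
      (fun x => (encard_le_encard fun y hy => hy.1.1).trans (hdeg x))
    refine ⟨C₀ ∩ C, ⟨hC₀.inter hC, ?_, ?_⟩, ?_⟩
    · intro x y hxy hx
      have hy := hinv hxy hx.1
      exact ⟨hy, hCinv x y ⟨hxy, hx.1, hy⟩ hx.2⟩
    · rw [compl_inter]
      exact measure_union_null hnull hCnull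
    · refine borelEdgeColorable_induce (Y := ULift.{u} (Fin (d + 1))) hc hcs ?_ ?_
        (fun n => ULift.up (Fin.ofNat (d + 1) n)) ?_
      · intro x y z hxy hxz
        exact hcp x y z ⟨⟨hxy.1, hxy.2.1.1, hxy.2.2.1⟩, hxy.2.1.2, hxy.2.2.2⟩
          ⟨⟨hxz.1, hxz.2.1.1, hxz.2.2.1⟩, hxz.2.1.2, hxz.2.2.2⟩
      · simp [hd]
      · intro x y z h
        have h1 := congrArg Fin.val (ULift.up_injective h)
        simpa [Nat.mod_eq_of_lt (Nat.lt_succ_of_le (hcd _ _))] using h1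
  -- Infinite maximum degree: `ℵ₀` colours are allowed and no further null set is discarded.
  · obtain ⟨c, hc, hcs, hcp⟩ := exists_nat_edgeColoring hG₀ hQm hQf hQcov
    refine ⟨C₀, ⟨hC₀, hinv, hnull⟩, borelEdgeColorable_induce (Y := ULift.{u} ℕ) hc hcs hcp ?_
      ULift.up fun x y z h => ULift.up_injective h⟩
    simpa using hΔ.trans (self_le_add_right _ _)

end BorelGraph

theorem theorem2 {X : Type u} [TopologicalSpace X] [PolishSpace X] [MeasurableSpace X]
    [BorelSpace X] (μ : Measure X) [IsProbabilityMeasure μ] (G : SimpleGraph X)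
    (hG : BorelGraph.IsBorel G) (hbip : G.IsBipartite)
    (hhyp : BorelGraph.IsMuHyperfinite G μ) :
    BorelGraph.muEdgeChromaticNumber G μ ≤ BorelGraph.maxDegree G + 1 ∧
      ∃ C : Set X, BorelGraph.IsInvariantConull G μ C ∧
        BorelGraph.BorelEdgeColorable (G.induce C) (BorelGraph.maxDegree G + 1) := by
  obtain ⟨C, hC, hcol⟩ := BorelGraph.exists_borelEdgeColorable_induce μ hG hbip hhyp
  refine ⟨?_, C, hC, hcol⟩
  have h : BorelGraph.muEdgeChromaticNumber G μ ≤
      BorelGraph.borelEdgeChromaticNumber (G.induce C) := csInf_le' ⟨C, hC, rfl⟩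
  have h' : BorelGraph.borelEdgeChromaticNumber (G.induce C) ≤ BorelGraph.maxDegree G + 1 :=
    csInf_le' hcol
  exact h.trans h'
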